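/- Let $\mathcal X\neq\{0\}$ be a reflexive real Banach space with dual $\mathcal X^*$ and duality pairing $\langle\cdot,\cdot\rangle$. Let $\varphi\colon\mathcal X\to\,]-\infty,+\infty]$ be proper (i.e., not identically $+\infty$), with conjugate $\varphi^*(u^*)=\sup_{x\in\mathcal X}\bigl(\langle x,u^*\rangle-\varphi(x)\bigr)$ and subdifferential $$\partial\varphi(x)=\{x^*\in\mathcal X^*\mid \langle y-x,x^*\rangle+\varphi(x)\le\varphi(y)\ \text{for all } y\in\mathcal X\}.$$ Define the Fenchel–Young function $L_\varphi(x,u^*)=\varphi(x)+\varphi^*(u^*)-\langle x,u^*\rangle$ and the Haraux function $$H_{\partial\varphi}(x,u^*)=\sup\{\langle x-y,y^*-u^*\rangle\mid y\in\mathcal X,\ y^*\in\partial\varphi(y)\}.$$ Let $W\colon\mathcal X\to2^{\mathcal X^*}$ be at most single-valued (each $Wy$ has at most one element), let $x\in\mathcal X$ satisfy $Wx\neq\varnothing$, let $u^*\in\mathcal X^*$ and $\gamma\in\,]0,+\infty[$. For $C\subset\mathcal X^*$, write $(W+\gamma\partial\varphi)^{-1}(C)$ for the set of those $y\in\mathcal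 X$ such that $C\cap(Wy+\gamma\,\partial\varphi(y))\neq\varnothing$. Suppose that there is a point $z\in(W+\gamma\partial\varphi)^{-1}(Wx+\gamma u^*)$. Consider the statements (a) $x\in(W+\gamma\partial\varphi)^{-1}(Wx+\gamma u^*)$; (b) $u^*\in\partial\varphi(x)$; (c) $L_\varphi(x,u^*)=0$; (d) $H_{\partial\varphi}(x,u^*)=0$. Then the following hold: (i) (a) $\Leftrightarrow$ (b) $\Leftrightarrow$ (c) $\Rightarrow$ (d). (ii) If $\varphi$ is in addition lower semicontinuous and convex (i.e., $\varphi\in\Gamma_0(\mathcal X)$), then (c) $\Leftrightarrow$ (d). -/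

import Mathlib

open scoped Pointwise

noncomputable section

namespace HarauxFY

variable {X : Type*} [NormedAddCommGroup X] [NormedSpace ℝ X]

/-- A real normed space is reflexive if the canonical isometric embedding into its topological
bidual is onto. -/
def IsReflexiveSpace (X : Type*) [NormedAddCommGroup X] [NormedSpace ℝ X] : Prop :=
  Function.Surjective (NormedSpace.inclusionInDoubleDual ℝ X)

/-- A set-valued operator from `X` to its topological dual. -/
abbrev SetOp (X : Type*) [NormedAddCommGroup X] [NormedSpace ℝ X] : Type _ :=
  X → Set (StrongDual ℝ X)

namespace SetOp

/-- The graph `{(x, x*) | x* ∈ A x}`. -/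
def gra (A : SetOp X) : Set (X × StrongDual ℝ X) := {p | p.2 ∈ A p.1}

/-- The domain `{x | A x ≠ ∅}`. -/
def dom (A : SetOp X) : Set X := {x | (A x).Nonempty}

/-- The inverse operator `x* ↦ {x | x* ∈ A x}`. -/
def inv (A : SetOp X) : StrongDual ℝ X → Set X := fun v => {x | v ∈ A x}

/-- The image `A⁻¹(C) = ⋃_{v ∈ C} A⁻¹ v` of a set `C` under the inverse operator. -/
def invImage (A : SetOp X) (C : Set (StrongDual ℝ X)) : Set X := ⋃ v ∈ C, A.inv v

/-- `A x` has at most one element for every `x`. -/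
def AtMostSingleValued (A : SetOp X) : Prop := ∀ x, (A x).Subsingleton

/-- The sum `W + γ A`, acting by `x ↦ W x + γ A x` (Minkowski sum; empty if one of the
two sets is). -/
def addSMul (W : SetOp X) (γ : ℝ) (A : SetOp X) : SetOp X := fun x => W x + γ • A x

/-- The Haraux function `H_A(x, u*) = sup_{(y, y*) ∈ gra A} ⟨x - y, y* - u*⟩`, with values in
`[-∞, +∞]`. -/
def haraux (A : SetOp X) (x : X) (u : StrongDual ℝ X) : EReal :=
  ⨆ p ∈ A.gra, (((p.2 - u) (x - p.1) : ℝ) : EReal)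

end SetOp

/-- A proper function with values in `]-∞, +∞]`: it never takes the value `-∞` and is not
identically `+∞`. -/
def IsProper (φ : X → EReal) : Prop := (∀ x, φ x ≠ ⊥) ∧ ∃ x, φ x < ⊤

/-- The class `Γ₀(X)` of proper lower semicontinuous convex functions from `X` to `]-∞, +∞]`;
convexity means convexity of the epigraph in `X × ℝ`. -/
structure IsGammaZero (φ : X → EReal) : Prop where
  proper : IsProper φ
  lsc : LowerSemicontinuous φ
  convex : Convex ℝ {p : X × ℝ | φ p.1 ≤ (p.2 : EReal)}

/-- The conjugate `φ*(u*) = sup_x (⟨x, u*⟩ - φ(x))`. -/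
def conjugate (φ : X → EReal) (u : StrongDual ℝ X) : EReal :=
  ⨆ x, ((u x : ℝ) : EReal) - φ x

/-- The subdifferential `∂φ(x) = {x* | ∀ y, ⟨y - x, x*⟩ + φ(x) ≤ φ(y)}`. -/
def subdifferential (φ : X → EReal) : SetOp X :=
  fun x => {v | ∀ y, ((v (y - x) : ℝ) : EReal) + φ x ≤ φ y}

/-- The Fenchel-Young function `L_φ(x, u*) = φ(x) + φ*(u*) - ⟨x, u*⟩`. -/
def fenchelYoung (φ : X → EReal) (x : X) (u : StrongDual ℝ X) : EReal :=
  φ x + conjugate φ u - ((u x : ℝ) : EReal)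

end HarauxFY

end

/-!
The equivalences between membership of `u` in `∂φ(x)`, the inclusion solved by `x`, and equality
in the Fenchel-Young inequality are algebraic: `W x` is a singleton, so it cancels, and
`L_φ(x, u) = 0` says that `⟨·, u⟩ - φ` attains its supremum at `x`. If `u ∈ ∂φ(x)`, then the
Haraux function is nonpositive at `(x, u)` because `∂φ` is monotone, and the pair `(x, u)` itself
contributes the value `0`.

The converse `H(x, u) = 0 → u ∈ ∂φ(x)` for `φ ∈ Γ₀(X)` is maximal monotonicity of `∂φ`. It comes
from the Minty-type lemma `exists_subgradient_add_half_sq`: there are `y` and `v ∈ ∂φ(y)` such that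
`u - v` is a subgradient of `½‖· - x‖²` at `y`. Evaluating the latter inequality at `x` gives
`½‖y - x‖² ≤ ⟨x - y, v - u⟩ ≤ H(x, u) = 0`, so `y = x`, and then `u - v = 0`.

The point `y` minimizes `φ - u + ½‖· - x‖²`. The given solution `z` provides a subgradient of `φ`,
hence a continuous affine minorant, so this function is bounded below with bounded sublevel sets;
nested bounded closed convex sets in a reflexive space meet (`exists_mem_iInter_of_reflexive`, from
the Banach-Alaoglu theorem), so the minimum is attained (`exists_minimizer_add_half_sq`).
The subgradient `v` comes from separating the epigraph of `φ - u` from the open strict hypograph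
of `m - ½‖· - x‖²`, where `m` is the minimum.
-/

namespace HarauxFY

/-! ### Subgradients and the Fenchel-Young equality -/

theorem IsProper.exists_real {Y : Type*} {φ : Y → EReal} (hφ : IsProper φ) {x : Y} (hx : φ x ≠ ⊤) :
    ∃ r : ℝ, φ x = r :=
  ⟨(φ x).toReal, (EReal.coe_toReal hx (hφ.1 x)).symm⟩

variable {X : Type*} [NormedAddCommGroup X] [NormedSpace ℝ X]

theorem IsProper.ne_top_of_mem_subdifferential {φ : X → EReal} (hφ : IsProper φ) {x : X}
    {v : StrongDual ℝ X} (hv : v ∈ subdifferential φ x) : φ x ≠ ⊤ := by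
  intro h
  obtain ⟨y, hy⟩ := hφ.2
  have := hv y
  rw [h, EReal.coe_add_top] at this
  exact hy.not_ge this

theorem mem_subdifferential_iff_fenchelYoung_eq_zero {φ : X → EReal} (hφ : IsProper φ) (x : X)
    (u : StrongDual ℝ X) : u ∈ subdifferential φ x ↔ fenchelYoung φ x u = 0 := by
  constructor
  · intro h
    obtain ⟨ρ, hρ⟩ := hφ.exists_real (hφ.ne_top_of_mem_subdifferential h)
    have hc : conjugate φ u = ((u x - ρ : ℝ) : EReal) := by
      apply le_antisymm
      · refine iSup_le fun y => ?_
        by_cases hy : φ y = ⊤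
        · simp [hy]
        · obtain ⟨σ, hσ⟩ := hφ.exists_real hy
          have h1 := h y
          rw [hρ, hσ] at h1
          rw [hσ]
          norm_cast at h1 ⊢
          rw [map_sub] at h1
          linarith
      · refine le_trans (le_of_eq ?_) (le_iSup (fun y => ((u y : ℝ) : EReal) - φ y) x)
        simp only [hρ]
        norm_cast
    rw [fenchelYoung, hc, hρ]
    norm_cast
    ring
  · intro h y
    have hle : ∀ w, ((u w : ℝ) : EReal) - φ w ≤ conjugate φ u :=
      fun w => le_iSup (fun w => ((u w : ℝ) : EReal) - φ w) w
    have hbot : conjugate φ u ≠ ⊥ := by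
      obtain ⟨w, hw⟩ := hφ.2
      obtain ⟨r, hr⟩ := hφ.exists_real hw.ne
      have h1 := hle w
      rw [hr] at h1
      norm_cast at h1
      exact ((EReal.bot_lt_coe _).trans_le h1).ne'
    have hx : φ x ≠ ⊤ := by
      intro hx
      rw [fenchelYoung, hx, EReal.top_add_of_ne_bot hbot] at h
      simp at h
    obtain ⟨ρ, hρ⟩ := hφ.exists_real hx
    have htop : conjugate φ u ≠ ⊤ := by
      intro hc
      rw [fenchelYoung, hc, hρ] at h
      simp at h
    obtain ⟨k, hk⟩ : ∃ k : ℝ, conjugate φ u = k := ⟨_, (EReal.coe_toReal htop hbot).symm⟩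
    by_cases hy : φ y = ⊤
    · simp [hy]
    · obtain ⟨σ, hσ⟩ := hφ.exists_real hy
      have h1 := hle y
      rw [fenchelYoung, hk, hρ] at h
      rw [hk, hσ] at h1
      rw [hρ, hσ]
      norm_cast at h h1 ⊢
      rw [map_sub]
      linarith

theorem haraux_eq_zero_of_mem_subdifferential {φ : X → EReal} (hφ : IsProper φ) {x : X}
    {u : StrongDual ℝ X} (hu : u ∈ subdifferential φ x) :
    (subdifferential φ).haraux x u = 0 := by
  obtain ⟨ρ, hρ⟩ := hφ.exists_real (hφ.ne_top_of_mem_subdifferential hu)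
  apply le_antisymm
  · refine iSup₂_le fun p hp => ?_
    replace hp : p.2 ∈ subdifferential φ p.1 := hp
    obtain ⟨σ, hσ⟩ := hφ.exists_real (hφ.ne_top_of_mem_subdifferential hp)
    have h1 := hu p.1
    have h2 := hp x
    rw [hρ, hσ] at h1 h2
    norm_cast at h1 h2 ⊢
    simp only [map_sub, sub_apply] at h1 h2 ⊢
    linarith
  · refine le_trans (le_of_eq ?_) (le_iSup₂_of_le (x, u) hu le_rfl)
    simp

/-- If `W x` is nonempty and `W` is at most single-valued, then `W x` cancels from the inclusion
`(W x + γ u) ∩ (W x + γ A x) ≠ ∅`. -/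
theorem mem_invImage_addSMul_iff {W : SetOp X} (hW : W.AtMostSingleValued) (A : SetOp X) {x : X}
    (hx : x ∈ W.dom) (u : StrongDual ℝ X) {γ : ℝ} (hγ : γ ≠ 0) :
    x ∈ (W.addSMul γ A).invImage (W x + {γ • u}) ↔ u ∈ A x := by
  simp only [SetOp.invImage, SetOp.inv, SetOp.addSMul, Set.mem_iUnion, Set.mem_ofPred_eq]
  constructor
  · rintro ⟨v, hv, hv'⟩
    obtain ⟨w, hw, _, rfl, rfl⟩ := Set.mem_add.1 hv
    obtain ⟨w', hw', _, ⟨s, hs, rfl⟩, h⟩ := Set.mem_add.1 hv'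
    rw [hW x hw' hw, add_right_inj] at h
    exact smul_right_injective _ hγ h ▸ hs
  · intro hu
    obtain ⟨w, hw⟩ := hx
    exact ⟨w + γ • u, Set.add_mem_add hw rfl, Set.add_mem_add hw (Set.smul_mem_smul_set hu)⟩

/-! ### Nested convex sets in a reflexive space -/

/-- Points of the sets cluster, along an ultrafilter, at some `y` weakly; a set missing `y` would be
strictly separated from it. -/
theorem exists_mem_iInter_of_reflexive (hX : IsReflexiveSpace X) {S : ℕ → Set X}
    (hanti : Antitone S) (hne : ∀ n, (S n).Nonempty) (hcl : ∀ n, IsClosed (S n))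
    (hconv : ∀ n, Convex ℝ (S n)) {R : ℝ} (hR : ∀ y ∈ S 0, ‖y‖ ≤ R) :
    ∃ y, ∀ n, y ∈ S n := by
  choose a ha using hne
  -- The points `a n`, read in the weak-star topology of the bidual.
  let F : ℕ → WeakDual ℝ (StrongDual ℝ X) :=
    fun n => StrongDual.toWeakDual (NormedSpace.inclusionInDoubleDual ℝ X (a n))
  have hK := WeakDual.isCompact_closedBall (𝕜 := ℝ) (0 : StrongDual ℝ (StrongDual ℝ X)) R
  have hF : ∀ n, F n ∈ WeakDual.toStrongDual ⁻¹'
      Metric.closedBall (0 : StrongDual ℝ (StrongDual ℝ X)) R := by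
    intro n
    refine (mem_closedBall_zero_iff (E := StrongDual ℝ (StrongDual ℝ X))).2 ?_
    exact (NormedSpace.double_dual_bound ℝ X (a n)).trans (hR _ (hanti (Nat.zero_le n) (ha n)))
  obtain ⟨Ψ, -, hΨ⟩ := hK.ultrafilter_le_nhds ((Filter.hyperfilter ℕ).map F)
    (Filter.le_principal_iff.2 (Filter.mem_map.2 (Filter.univ_mem' hF)))
  obtain ⟨y, hy⟩ := hX (WeakDual.toStrongDual Ψ)
  refine ⟨y, fun k => by_contra fun hk => ?_⟩
  obtain ⟨f, c, hfy, hfS⟩ := geometric_hahn_banach_point_closed (hconv k) (hcl k) hk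
  have hlim : Filter.Tendsto (fun n => f (a n)) (Filter.hyperfilter ℕ : Filter ℕ)
      (nhds (f y)) := by
    have h1 : Filter.Tendsto F (Filter.hyperfilter ℕ : Filter ℕ) (nhds Ψ) := hΨ
    have h2 := ((WeakDual.eval_continuous f).tendsto Ψ).comp h1
    have h3 : Ψ f = f y := by
      have := congrArg (fun g : StrongDual ℝ (StrongDual ℝ X) => g f) hy
      simpa using this.symm
    rw [h3] at h2
    exact h2
  have hge : ∀ᶠ n in (Filter.hyperfilter ℕ : Filter ℕ), c ≤ f (a n) := by
    have : ∀ᶠ n in (Filter.hyperfilter ℕ : Filter ℕ), k ≤ n :=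
      Nat.hyperfilter_le_atTop (Filter.eventually_ge_atTop k)
    filter_upwards [this] with n hn
    exact (hfS _ (hanti hn (ha n))).le
  exact hfy.not_ge (ge_of_tendsto hlim hge)

/-! ### Quadratic perturbation of a convex function -/

theorem half_sq_norm_convex {a b : ℝ} (ha : 0 ≤ a) (hb : 0 ≤ b) (hab : a + b = 1) (x y w : X) :
    ‖a • y + b • w - x‖ ^ 2 ≤ a * ‖y - x‖ ^ 2 + b * ‖w - x‖ ^ 2 := by
  have h1 : a • y + b • w - x = a • (y - x) + b • (w - x) := by
    have : x = a • x + b • x := by rw [← add_smul, hab, one_smul]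
    nth_rewrite 1 [this]
    module
  have h2 : ‖a • y + b • w - x‖ ≤ a * ‖y - x‖ + b * ‖w - x‖ := by
    rw [h1]
    refine (norm_add_le _ _).trans (le_of_eq ?_)
    rw [norm_smul, norm_smul, Real.norm_of_nonneg ha, Real.norm_of_nonneg hb]
  have h3 : ‖a • y + b • w - x‖ ^ 2 ≤ (a * ‖y - x‖ + b * ‖w - x‖) ^ 2 := by gcongr
  obtain rfl : b = 1 - a := by linarith
  nlinarith [mul_nonneg (mul_nonneg ha hb) (sq_nonneg (‖y - x‖ - ‖w - x‖))]

/-- `φ - u + ½‖· - x‖²` attains its infimum `m`. Both statements are phrased through real upper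
bounds of `φ`, which avoids subtraction in `EReal`. -/
theorem exists_minimizer_add_half_sq (hX : IsReflexiveSpace X) {φ : X → EReal}
    (hφ : IsGammaZero φ) {z : X} {s : StrongDual ℝ X} (hs : s ∈ subdifferential φ z) (x : X)
    (u : StrongDual ℝ X) :
    ∃ (m : ℝ) (y : X), φ y ≤ ((m + u (y - x) - ‖y - x‖ ^ 2 / 2 : ℝ) : EReal) ∧
      ∀ (w : X) (r : ℝ), φ w ≤ r → m ≤ r - u (w - x) + ‖w - x‖ ^ 2 / 2 := by
  obtain ⟨ρ, hρ⟩ := hφ.proper.exists_real (hφ.proper.ne_top_of_mem_subdifferential hs)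
  let S : ℝ → Set X := fun t => {y | φ y ≤ ((t + u (y - x) - ‖y - x‖ ^ 2 / 2 : ℝ) : EReal)}
  have hepi : IsClosed {p : X × ℝ | φ p.1 ≤ (p.2 : EReal)} := by
    have h1 : IsClosed {p : X × EReal | φ p.1 ≤ p.2} := hφ.lsc.isClosed_epigraph
    exact h1.preimage (f := fun p : X × ℝ => (p.1, (p.2 : EReal))) 
      (continuous_fst.prodMk (continuous_coe_real_ereal.comp continuous_snd))
  have hScl : ∀ t, IsClosed (S t) := fun t =>
    hepi.preimage (f := fun y : X => (y, t + u (y - x) - ‖y - x‖ ^ 2 / 2)) (by fun_prop)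
  have hSconv : ∀ t, Convex ℝ (S t) := by
    intro t y hy w hw a b ha hb hab
    have h1 := hφ.convex (x := (y, t + u (y - x) - ‖y - x‖ ^ 2 / 2)) hy
      (y := (w, t + u (w - x) - ‖w - x‖ ^ 2 / 2)) hw ha hb hab
    simp only [Set.mem_ofPred_eq, Prod.smul_mk, Prod.mk_add_mk, smul_eq_mul] at h1
    refine h1.trans (EReal.coe_le_coe_iff.2 ?_)
    have h2 := half_sq_norm_convex ha hb hab x y w
    simp only [map_sub, map_add, map_smul, smul_eq_mul]
    obtain rfl : b = 1 - a := by linarith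
    nlinarith
  have hSmono : Monotone S := by
    intro t t' h y hy
    refine le_trans (show φ y ≤ _ from hy) (EReal.coe_le_coe_iff.2 ?_)
    linarith
  -- The subgradient at `z` gives an affine minorant, hence a quadratic growth estimate.
  have hgrow : ∀ t, ∀ y ∈ S t,
      ‖y - x‖ ^ 2 / 2 - ‖s - u‖ * ‖y - x‖ + (s (x - z) + ρ) ≤ t := by
    intro t y hy
    have h1 := (hs y).trans hy
    rw [hρ] at h1
    norm_cast at h1
    have h2 := (abs_le.1 ((s - u).le_opNorm (y - x))).1
    simp only [map_sub, sub_apply] at h1 h2 ⊢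
    linarith
  let T : Set ℝ := {t | (S t).Nonempty}
  have hTb : BddBelow T := by
    refine ⟨-(‖s - u‖ ^ 2 / 2) + (s (x - z) + ρ), ?_⟩
    rintro t ⟨y, hy⟩
    nlinarith [hgrow t y hy, sq_nonneg (‖y - x‖ - ‖s - u‖)]
  have hTmem : ∀ (w : X) (r : ℝ), φ w ≤ r → r - u (w - x) + ‖w - x‖ ^ 2 / 2 ∈ T := by
    intro w r h
    refine ⟨w, h.trans (EReal.coe_le_coe_iff.2 (le_of_eq ?_))⟩
    ring
  have hTne : T.Nonempty := ⟨_, hTmem z ρ hρ.le⟩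
  have hpos : ∀ n : ℕ, (0 : ℝ) < 1 / ((n : ℝ) + 1) := fun n => by positivity
  obtain ⟨y, hy⟩ := exists_mem_iInter_of_reflexive hX
    (S := fun n : ℕ => S (sInf T + 1 / ((n : ℝ) + 1)))
    (fun i j hij => hSmono (add_le_add_right (Nat.one_div_le_one_div hij) _))
    (fun n => by
      obtain ⟨t, ht, htn⟩ := exists_lt_of_csInf_lt hTne (lt_add_of_pos_right (sInf T) (hpos n))
      exact ht.mono (hSmono htn.le))
    (fun n => hScl _) (fun n => hSconv _)
    (R := ‖x‖ + (2 * ‖s - u‖ + 1 + 2 * |sInf T + 1 - (s (x - z) + ρ)|)) (by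
      intro y hy
      have h1 := hgrow _ y hy
      norm_num at h1
      have h2 := le_abs_self (sInf T + 1 - (s (x - z) + ρ))
      have h3 : ‖y‖ ≤ ‖x‖ + ‖y - x‖ := by simpa using norm_add_le x (y - x)
      have h4 : ‖y - x‖ ≤ 2 * ‖s - u‖ + 1 + 2 * |sInf T + 1 - (s (x - z) + ρ)| := by
        by_contra! h
        rw [map_sub] at h2 h
        nlinarith [norm_nonneg (s - u), abs_nonneg (sInf T + 1 - (s x - s z + ρ)),
          norm_nonneg (y - x)]
      linarith)
  refine ⟨sInf T, y, ?_, fun w r h => csInf_le hTb (hTmem w r h)⟩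
  have hyS : φ y ≤ _ := hy 0
  obtain ⟨σ, hσ⟩ := hφ.proper.exists_real (hyS.trans_lt (EReal.coe_lt_top _)).ne
  rw [hσ]
  refine EReal.coe_le_coe_iff.2 (le_of_forall_pos_le_add fun ε hε => ?_)
  obtain ⟨n, hn⟩ := exists_nat_one_div_lt hε
  have hyn : φ y ≤ _ := hy n
  rw [hσ, EReal.coe_le_coe_iff] at hyn
  linarith

/-- Minty-type surjectivity: `u` splits as the sum of a subgradient `v` of `φ` and a subgradient
`u - v` of `½‖· - x‖²`, both at the same point `y`. -/
theorem exists_subgradient_add_half_sq (hX : IsReflexiveSpace X) {φ : X → EReal}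
    (hφ : IsGammaZero φ) {z : X} {s : StrongDual ℝ X} (hs : s ∈ subdifferential φ z) (x : X)
    (u : StrongDual ℝ X) :
    ∃ (y : X) (v : StrongDual ℝ X), v ∈ subdifferential φ y ∧
      ∀ w, ‖y - x‖ ^ 2 / 2 + (u - v) (w - y) ≤ ‖w - x‖ ^ 2 / 2 := by
  obtain ⟨m, y, hy, hm⟩ := exists_minimizer_add_half_sq hX hφ hs x u
  obtain ⟨σ, hσ⟩ := hφ.proper.exists_real (hy.trans_lt (EReal.coe_lt_top _)).ne
  let A : Set (X × ℝ) := {p | φ p.1 ≤ ((p.2 + u (p.1 - x) : ℝ) : EReal)}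
  let B : Set (X × ℝ) := {p | p.2 < m - ‖p.1 - x‖ ^ 2 / 2}
  have hA : Convex ℝ A := by
    intro p hp q hq a b ha hb hab
    have h1 := hφ.convex (x := (p.1, p.2 + u (p.1 - x))) hp
      (y := (q.1, q.2 + u (q.1 - x))) hq ha hb hab
    simp only [Set.mem_ofPred_eq, Prod.smul_mk, Prod.mk_add_mk, smul_eq_mul] at h1
    refine h1.trans (EReal.coe_le_coe_iff.2 (le_of_eq ?_))
    simp only [map_sub, map_add, map_smul, smul_eq_mul, Prod.fst_add, Prod.snd_add, Prod.smul_fst,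
      Prod.smul_snd]
    obtain rfl : b = 1 - a := by linarith
    ring
  have hB : Convex ℝ B := by
    intro p hp q hq a b ha hb hab
    have h2 := half_sq_norm_convex ha hb hab x p.1 q.1
    have hp' : p.2 < m - ‖p.1 - x‖ ^ 2 / 2 := hp
    have hq' : q.2 < m - ‖q.1 - x‖ ^ 2 / 2 := hq
    have h3 : a * p.2 + b * q.2 <
        a * (m - ‖p.1 - x‖ ^ 2 / 2) + b * (m - ‖q.1 - x‖ ^ 2 / 2) := by
      rcases ha.eq_or_lt with rfl | ha'
      · obtain rfl : b = 1 := by linarith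
        linarith
      · exact add_lt_add_of_lt_of_le (mul_lt_mul_of_pos_left hp' ha')
          (mul_le_mul_of_nonneg_left hq'.le hb)
    change a * p.2 + b * q.2 < m - ‖a • p.1 + b • q.1 - x‖ ^ 2 / 2
    obtain rfl : b = 1 - a := by linarith
    linarith
  have hBo : IsOpen B := isOpen_lt (by fun_prop) (by fun_prop)
  have hdisj : Disjoint B A := by
    rw [Set.disjoint_left]
    intro p hp hpA
    have h1 := hm p.1 _ hpA
    have h2 : p.2 < m - ‖p.1 - x‖ ^ 2 / 2 := hp
    linarith
  obtain ⟨f, c, hfB, hfA⟩ := geometric_hahn_banach_open hB hBo hA hdisj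
  let p : StrongDual ℝ X := f.comp (ContinuousLinearMap.inl ℝ X ℝ)
  let β : ℝ := f (0, 1)
  have hf : ∀ (w : X) (r : ℝ), f (w, r) = p w + β * r := by
    intro w r
    have h1 : (w, r) = (w, (0 : ℝ)) + r • ((0 : X), (1 : ℝ)) := by simp
    rw [h1, map_add, map_smul, smul_eq_mul, mul_comm r]
    rfl
  have hmem : ∀ (w : X) (r : ℝ), φ w ≤ r → c ≤ p w + β * (r - u (w - x)) := by
    intro w r h
    rw [← hf]
    refine hfA _ (show φ w ≤ _ from h.trans (EReal.coe_le_coe_iff.2 ?_))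
    simp
  have hylow := hmem y σ hσ.le
  rw [hσ, EReal.coe_le_coe_iff] at hy
  have hlow : ∀ (w : X) (r : ℝ), r < m - ‖w - x‖ ^ 2 / 2 → p w + β * r < c := by
    intro w r h
    rw [← hf]
    exact hfB _ h
  -- `A` and `B` both meet the vertical line through `y`, so the separating functional is not
  -- vertical.
  have hβ : 0 < β := by
    have h1 := hm y σ hσ.le
    have h2 := hlow y (m - ‖y - x‖ ^ 2 / 2 - 1) (by linarith)
    nlinarith
  have hclow : ∀ w, p w + β * (m - ‖w - x‖ ^ 2 / 2) ≤ c := by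
    intro w
    refine le_of_forall_pos_le_add fun ε hε => ?_
    have h1 := hlow w (m - ‖w - x‖ ^ 2 / 2 - ε / β) (by linarith [div_pos hε hβ])
    have h2 : β * (ε / β) = ε := mul_div_cancel₀ ε hβ.ne'
    linarith
  have hc : c = p y + β * (σ - u (y - x)) := by
    refine le_antisymm hylow (le_trans ?_ (hclow y))
    have := mul_le_mul_of_nonneg_left
      (show σ - u (y - x) ≤ m - ‖y - x‖ ^ 2 / 2 by linarith) hβ.le
    linarith
  have hp : ∀ w, β * ((β⁻¹ • p) w) = p w := by
    intro w
    rw [smul_apply, smul_eq_mul, mul_inv_cancel_left₀ hβ.ne']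
  refine ⟨y, u - β⁻¹ • p, fun w => ?_, fun w => ?_⟩
  · by_cases hw : φ w = ⊤
    · simp [hw]
    · obtain ⟨τ, hτ⟩ := hφ.proper.exists_real hw
      rw [hσ, hτ]
      norm_cast
      have h1 := hmem w τ hτ.le
      rw [hc, ← hp y, ← hp w, ← mul_add, ← mul_add] at h1
      have h2 := le_of_mul_le_mul_left h1 hβ
      simp only [map_sub, sub_apply] at h2 ⊢
      linarith
  · have h1 := hclow w
    have h3 := hm y σ hσ.le
    rw [hc, ← hp y, ← hp w, ← mul_add, ← mul_add] at h1
    have h2 := le_of_mul_le_mul_left h1 hβ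
    rw [sub_sub_cancel]
    simp only [map_sub] at h2 h3 hy ⊢
    linarith

/-- Maximal monotonicity of `∂φ`: a pair monotonically related to its graph lies on it. The
hypothesis `hs` only provides a continuous affine minorant of `φ`. -/
theorem mem_subdifferential_of_haraux_eq_zero (hX : IsReflexiveSpace X) {φ : X → EReal}
    (hφ : IsGammaZero φ) {z : X} {s : StrongDual ℝ X} (hs : s ∈ subdifferential φ z) {x : X}
    {u : StrongDual ℝ X} (hH : (subdifferential φ).haraux x u = 0) :
    u ∈ subdifferential φ x := by
  obtain ⟨y, v, hv, hq⟩ := exists_subgradient_add_half_sq hX hφ hs x u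
  have h1 : (v - u) (x - y) ≤ 0 := by
    have : (((v - u) (x - y) : ℝ) : EReal) ≤ (subdifferential φ).haraux x u :=
      le_iSup₂_of_le (f := fun (p : X × StrongDual ℝ X)
        (_ : p ∈ (subdifferential φ).gra) => (((p.2 - u) (x - p.1) : ℝ) : EReal))
        (y, v) hv le_rfl
    rw [hH] at this
    exact_mod_cast this
  have h2 := hq x
  have h3 : ‖y - x‖ = 0 := by
    rw [← neg_sub u v, neg_apply] at h1
    simp only [sub_self, norm_zero] at h2
    nlinarith [norm_nonneg (y - x)]
  obtain rfl : y = x := sub_eq_zero.1 (norm_eq_zero.1 h3)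
  -- A linear functional bounded above by `½‖·‖²` vanishes.
  have h4 : ∀ w, (u - v) w ≤ 0 := by
    intro w
    by_contra! hw
    have h5 : ∀ t : ℝ, t * (u - v) w ≤ t ^ 2 * ‖w‖ ^ 2 / 2 := by
      intro t
      have := hq (y + t • w)
      simpa [norm_smul, mul_pow] using this
    have h6 := h5 ((u - v) w / (‖w‖ ^ 2 + 1))
    have h7 : 0 < ‖w‖ ^ 2 + 1 := by positivity
    rw [div_mul_eq_mul_div, div_pow, div_mul_eq_mul_div, div_div, div_le_div_iff₀ h7 (by positivity)]
      at h6
    have h8 : 0 < ((u - v) w) ^ 2 * (‖w‖ ^ 2 + 1) := by positivity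
    nlinarith [sq_nonneg ‖w‖, mul_nonneg h8.le (sq_nonneg ‖w‖)]
  have h5 : u - v = 0 := by
    ext w
    have := h4 (-w)
    rw [map_neg] at this
    exact le_antisymm (h4 w) (neg_nonpos.1 this)
  rwa [sub_eq_zero.1 h5]

end HarauxFY

theorem proposition4p3
    {X : Type*} [NormedAddCommGroup X] [NormedSpace ℝ X] [CompleteSpace X] [Nontrivial X]
    (hX : HarauxFY.IsReflexiveSpace X)
    (φ : X → EReal) (hφ : HarauxFY.IsProper φ)
    (W : HarauxFY.SetOp X) (hW : W.AtMostSingleValued)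
    (x : X) (hx : x ∈ W.dom) (u : StrongDual ℝ X) (γ : ℝ) (hγ : 0 < γ)
    (z : X)
    (hz : z ∈ (W.addSMul γ (HarauxFY.subdifferential φ)).invImage (W x + {γ • u})) :
    ((x ∈ (W.addSMul γ (HarauxFY.subdifferential φ)).invImage (W x + {γ • u}) ↔
        u ∈ HarauxFY.subdifferential φ x) ∧
      (u ∈ HarauxFY.subdifferential φ x ↔ HarauxFY.fenchelYoung φ x u = 0) ∧
      (HarauxFY.fenchelYoung φ x u = 0 →
        (HarauxFY.subdifferential φ).haraux x u = 0)) ∧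
    (HarauxFY.IsGammaZero φ →
      (HarauxFY.fenchelYoung φ x u = 0 ↔ (HarauxFY.subdifferential φ).haraux x u = 0)) := by
  have hbc := HarauxFY.mem_subdifferential_iff_fenchelYoung_eq_zero hφ x u
  have hbd := HarauxFY.haraux_eq_zero_of_mem_subdifferential hφ (x := x) (u := u)
  refine ⟨⟨HarauxFY.mem_invImage_addSMul_iff hW _ hx u hγ.ne', hbc, fun h => hbd (hbc.2 h)⟩,
    fun hΓ => ⟨fun h => hbd (hbc.2 h), fun h => hbc.1 ?_⟩⟩
  -- The solution `z` is only needed to know that `∂φ z` is nonempty.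
  simp only [HarauxFY.SetOp.invImage, HarauxFY.SetOp.inv, HarauxFY.SetOp.addSMul, Set.mem_iUnion,
    Set.mem_ofPred_eq] at hz
  obtain ⟨_, -, hv⟩ := hz
  obtain ⟨_, -, _, ⟨s, hs, rfl⟩, -⟩ := Set.mem_add.1 hv
  exact HarauxFY.mem_subdifferential_of_haraux_eq_zero hX hΓ hs h
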